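/- Let $P$ be a finite set of points in the Euclidean plane. Partition the plane around each point $u$ into five equiangular cones with apex $u$, labelled $C_0,\dots,C_4$ in clockwise order, such that the bisector of $C_0$ points in the direction of the positive $y$-axis; the boundary between two consecutive cones belongs to the counter-clockwise one. Assume that $P$ is in general position: no two distinct points of $P$ lie on a line parallel or perpendicular to a cone boundary. The graph $\Theta_5$ on $P$ is the undirected graph with vertex set $P$ in which each vertex $u$ is joined, for each cone $C$ of $u$ that contains another point of $P$, to the point $v \in P\cap C$, $v\ne u$, whose orthogonal projection on the bisector of $C$ is closest to $u$. The length of a path is the sum of the Euclidean lengths of its edges; a graph on $P$ is a geometric $t$-spanner if every two points $u,w\in P$ are joined by a path of length at most $t\,|uw|$, and its spanning ratio is the smallest $t\ge 0$ for which it is a geometric $t$-spanner ($\infty$ if there is none). Then $\Theta_5$ is a geometric $t$-spanner for $t=\sqrt{50+22\sqrt5}\approx 9.960$; that is, its spanning ratio is at most $\sqrt{50+22\sqrt5}$. -/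

import Mathlib

open scoped NNReal ENNReal

noncomputable section

/-- The Euclidean plane. -/
abbrev Plane : Type := EuclideanSpace ℝ (Fin 2)

/-- The unit vector that makes the clockwise angle `φ` with the positive `y`-axis. -/
def clockDir (φ : ℝ) : Plane := !₂[Real.sin φ, Real.cos φ]

/-- The direction of the bisector of the cone `C_i` (out of `k` cones labelled clockwise); the
bisector of `C_0` is the positive `y`-axis. -/
def bisectorDir (k i : ℕ) : Plane := clockDir (2 * Real.pi * i / k)

/-- The direction of the boundary between the cones `C_i` and `C_(i+1)` (indices mod `k`). -/
def boundaryDir (k i : ℕ) : Plane := clockDir ((2 * i + 1) * Real.pi / k)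

/-- The cone `C_i` with apex `a`, out of the `k` equiangular cones around `a` (the apex itself is
not included). The boundary between two consecutive cones belongs to the counter-clockwise one. -/
def cone (k i : ℕ) (a : Plane) : Set Plane :=
  {x | ∃ r φ : ℝ, 0 < r ∧ (2 * i - 1) * Real.pi / k < φ ∧ φ ≤ (2 * i + 1) * Real.pi / k ∧
    x = a + r • clockDir φ}

/-- How far from `a`, along the bisector of the cone `C_i` with apex `a`, the orthogonal projection
of `x` on this bisector lies. -/
def bisectorProj (k i : ℕ) (a x : Plane) : ℝ := inner ℝ (bisectorDir k i) (x - a)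

/-- `v` is a closest vertex to `u`, among the points of `P` in the cone `C_i` of `u`: its projection
on the bisector is closest to `u`. -/
def IsClosestInCone (k i : ℕ) (P : Finset Plane) (u v : Plane) : Prop :=
  v ∈ P ∧ v ∈ cone k i u ∧
    ∀ x ∈ P, x ∈ cone k i u → bisectorProj k i u v ≤ bisectorProj k i u x

/-- The graph `Θ_k` on the point set `P` (for `k ≥ 3`): every vertex gets an (undirected) edge to the
closest vertex in each of its `k` cones. -/
def thetaGraph (k : ℕ) (P : Finset Plane) : SimpleGraph P :=
  SimpleGraph.fromRel fun u v => ∃ i < k, IsClosestInCone k i P u v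

/-- General position: no two points of `P` lie on a line that is parallel or perpendicular to one of
the boundaries of the `k` cones. -/
def InGeneralPosition (k : ℕ) (P : Finset Plane) : Prop :=
  ∀ p ∈ P, ∀ q ∈ P, p ≠ q → ∀ i < k,
    (∀ r : ℝ, q - p ≠ r • boundaryDir k i) ∧ inner ℝ (boundaryDir k i) (q - p) ≠ 0

/-- The length of a walk in a graph on points of the plane: the sum of the Euclidean lengths of its
edges. -/
def walkLength {P : Finset Plane} {G : SimpleGraph P} {u v : P} (p : G.Walk u v) : ℝ :=
  (p.darts.map fun d => dist (d.fst : Plane) (d.snd : Plane)).sum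

/-- `G` is a geometric `t`-spanner of `P`: between any two points there is a path in `G` whose length
is at most `t` times their Euclidean distance. -/
def IsGeometricSpanner {P : Finset Plane} (G : SimpleGraph P) (t : ℝ) : Prop :=
  ∀ u v : P, ∃ p : G.Walk u v, p.IsPath ∧ walkLength p ≤ t * dist (u : Plane) (v : Plane)

/-- The spanning ratio of `G`: the smallest `t ≥ 0` for which `G` is a geometric `t`-spanner, and
`∞` if there is none. -/
def spanningRatio {P : Finset Plane} (G : SimpleGraph P) : ℝ≥0∞ :=
  ⨅ (t : ℝ≥0) (_ : IsGeometricSpanner G t), (t : ℝ≥0∞)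

end

/-! Scale the projections on the five bisectors by `1 / cos (π / 5)`. Their maximum at `w - u` is
the leg length of the canonical triangle from `u` to `w`, an asymmetric gauge `g` whose unit ball is
a regular pentagon. With `c = 4φ + 2`, some walk from `u` to `w` has length at most `c * g (w - u)`,
by induction on the gauge over the finitely many ordered pairs.

If `g (u - w) < g (w - u)`, reverse the pair. Otherwise let `v` be the neighbour of `u` in its cone
containing `w`, and `q` that of `w` in its cone containing `u`. Stepping to `v`, stepping to `q`, or
doing both and then joining `q` to `v` lowers `c * g` by at least the gauge cost of the steps, which
bounds their Euclidean length (`step_trichotomy`, `exists_step`). Any three consecutive projections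
are linearly related, so two of them determine all five, and the trichotomy reduces to linear
inequalities over `ℤ[φ]`.

Finally the walk is taken in the cheaper direction: `min_gauge_le` bounds `c * min (g x) (g (-x))`
by `√(50 + 22√5) * ‖x‖`. -/

noncomputable section

open scoped goldenRatio

/-! ### Pentagonal families. -/

/-- The five values that a linear functional family with pentagonal symmetry takes at a vector:
the projections of the vector on five equiangular directions, up to a common factor. -/
def IsPentagonal (f : ZMod 5 → ℝ) : Prop :=
  ∀ i, f (i - 1) + f (i + 1) = (φ - 1) * f i

namespace IsPentagonal

theorem shift {f : ZMod 5 → ℝ} (hf : IsPentagonal f) (k : ZMod 5) :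
    IsPentagonal fun i => f (k + i) := by
  intro i
  have h := hf (k + i)
  rwa [add_sub_assoc, add_assoc] at h

theorem reflect {f : ZMod 5 → ℝ} (hf : IsPentagonal f) (k : ZMod 5) :
    IsPentagonal fun i => f (k - i) := by
  intro i
  have h := hf (k - i)
  rw [show k - i - 1 = k - (i + 1) by ring, show k - i + 1 = k - (i - 1) by ring] at h
  rw [add_comm]
  exact h

theorem apply_two {f : ZMod 5 → ℝ} (hf : IsPentagonal f) : f 2 = (φ - 1) * f 1 - f 0 := by
  have h := hf 1
  rw [show (1 - 1 : ZMod 5) = 0 by decide, show (1 + 1 : ZMod 5) = 2 by decide] at h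
  linarith

theorem apply_four {f : ZMod 5 → ℝ} (hf : IsPentagonal f) : f 4 = (φ - 1) * f 0 - f 1 := by
  have h := hf 0
  rw [show (0 - 1 : ZMod 5) = 4 by decide, show (0 + 1 : ZMod 5) = 1 by decide] at h
  linarith

theorem apply_three {f : ZMod 5 → ℝ} (hf : IsPentagonal f) :
    f 3 = -((φ - 1) * (f 0 + f 1)) := by
  have h := hf 2
  rw [show (2 - 1 : ZMod 5) = 1 by decide, show (2 + 1 : ZMod 5) = 3 by decide,
    hf.apply_two] at h
  linear_combination h + f 1 * Real.goldenRatio_sq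

/-- A nonzero pentagonal family takes its minimum opposite to its maximum. -/
theorem min_opposite_zero {f : ZMod 5 → ℝ} (hf : IsPentagonal f) (h0 : ∀ j, f j ≤ f 0)
    {k : ZMod 5} (hk : ∀ j, f k ≤ f j) : k = 2 ∨ k = 3 ∨ f 0 = 0 := by
  have h2 := hf.apply_two
  have h3 := hf.apply_three
  have h4 := hf.apply_four
  have g1 := Real.one_lt_goldenRatio
  have g2 := Real.goldenRatio_lt_two
  have g3 : 3 / 2 < φ := by nlinarith [Real.goldenRatio_sq]
  have gs := Real.goldenRatio_sq
  have e1 := h0 1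
  have e4 := h0 4
  have e2 := h0 2
  have e3 := h0 3
  have k0 := hk 0
  have k1 := hk 1
  have k2 := hk 2
  have k3 := hk 3
  have k4 := hk 4
  have hk' : ∀ k : ZMod 5, k = 0 ∨ k = 1 ∨ k = 2 ∨ k = 3 ∨ k = 4 := by decide
  have hnn : 0 ≤ f 0 := by
    by_contra hneg
    nlinarith
  rcases hk' k with rfl | rfl | rfl | rfl | rfl
  · right; right
    nlinarith
  · right; right
    -- These are `f 1 ≤ f 2` and `f 4 ≤ f 0`; chained, they give `f 0 ≤ (2 - φ)² * f 0` with `0 < 2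
    -- - φ < 1`.
    have a1 : f 0 ≤ (2 - φ) * -f 1 := by linarith
    have a2 : -f 1 ≤ (2 - φ) * f 0 := by linarith
    nlinarith [mul_le_mul_of_nonneg_left a2 (by linarith : (0 : ℝ) ≤ 2 - φ)]
  · simp
  · simp
  · right; right
    -- This is `f 4 ≤ f 3`; with `f 1 ≤ f 0` it gives `(3φ - 4) * f 0 ≤ 0`, where `3φ > 4`.
    have a1 : 2 * (φ - 1) * f 0 ≤ (2 - φ) * f 1 := by linarith
    have a2 := mul_le_mul_of_nonneg_left e1 (by linarith : (0 : ℝ) ≤ 2 - φ)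
    nlinarith

end IsPentagonal


/-! ### Linear inequalities for the three kinds of step. -/

/-- Here `a, b` and `s, t` are the components 0 and 1 of `w` and `v`. Components 0, 2, 3, 4 of the
source step never fail; component 1 is the only possible obstruction. -/
theorem source_step_bound {a b s t : ℝ}
    (w01 : 0 ≤ a - b)
    (w34 : 0 ≤ ((φ - 1) * a - b) - (-((φ - 1) * (a + b))))
    (w04 : 0 ≤ a - ((φ - 1) * a - b))
    (w03 : 0 ≤ (φ - 1) * (a + b) - a)
    (v01 : 0 ≤ s - t)
    (v04 : 0 ≤ s - ((φ - 1) * s - t))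
    (vw : 0 ≤ a - s)
    (v0 : 0 ≤ s) :
    s + (4 * φ + 2) * (a - s) ≤ (4 * φ + 2) * a ∧
    s + (4 * φ + 2) * (((φ - 1) * b - a) - ((φ - 1) * t - s)) ≤ (4 * φ + 2) * a ∧
    s + (4 * φ + 2) * ((-((φ - 1) * (a + b))) - (-((φ - 1) * (s + t)))) ≤ (4 * φ + 2) * a ∧
    s + (4 * φ + 2) * (((φ - 1) * a - b) - ((φ - 1) * s - t)) ≤ (4 * φ + 2) * a := by
  have g1 := Real.one_lt_goldenRatio
  -- Powers of `φ` are reduced by `φ² = φ + 1`, so that each goal becomes a combination of the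
  -- hypotheses with the nonnegative multipliers `k` listed below.
  have r2 : ∀ z : ℝ, φ * (φ * z) = φ * z + z := fun z => by
    linear_combination z * Real.goldenRatio_sq
  have r3 : ∀ z : ℝ, φ * (φ * (φ * z)) = 2 * (φ * z) + z := fun z => by
    linear_combination (φ * z + z) * Real.goldenRatio_sq
  have scale : ∀ {k z : ℝ}, 0 ≤ k → 0 ≤ z → 0 ≤ k * z := fun hk hz => mul_nonneg hk hz
  refine ⟨?_, ?_, ?_, ?_⟩
  · linarith [r2 a, r3 a, r2 b, r3 b, r2 s, r3 s, r2 t, r3 t,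
      scale (k := 4 * φ + 1) (by linarith) v0]
  · linarith [r2 a, r3 a, r2 b, r3 b, r2 s, r3 s, r2 t, r3 t,
      scale (k := 1) (by linarith) w03,
      scale (k := 3 * φ + 1) (by linarith) w01,
      scale (k := 4 * φ + 5) (by linarith) vw,
      scale (k := 2 * φ + 2) (by linarith) v04]
  · linarith [r2 a, r3 a, r2 b, r3 b, r2 s, r3 s, r2 t, r3 t,
      scale (k := 4 * φ - 1) (by linarith) w34,
      scale (k := 3 * φ + 7) (by linarith) w03,
      scale (k := 4 * φ + 5) (by linarith) vw,
      scale (k := 2 * φ + 2) (by linarith) v01]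
  · linarith [r2 a, r3 a, r2 b, r3 b, r2 s, r3 s, r2 t, r3 t,
      scale (k := 2 * φ + 1) (by linarith) w04,
      scale (k := 3 * φ + 2) (by linarith) w03,
      scale (k := 4 * φ + 2) (by linarith) v01,
      scale (k := 2 * φ + 1) (by linarith) vw]

/-- Here `x, y` are the components 0 and 1 of `p`. For the target step, component 4 is the only
possible obstruction. -/
theorem target_step_bound {a b x y : ℝ}
    (w01 : 0 ≤ a - b)
    (w32 : 0 ≤ ((φ - 1) * b - a) - (-((φ - 1) * (a + b))))
    (w34 : 0 ≤ ((φ - 1) * a - b) - (-((φ - 1) * (a + b))))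
    (p32 : 0 ≤ (-((φ - 1) * (x + y))) - ((φ - 1) * y - x))
    (p34 : 0 ≤ (-((φ - 1) * (x + y))) - ((φ - 1) * x - y))
    (pw : 0 ≤ (φ - 1) * (a + b) - (-((φ - 1) * (x + y)))) :
    -((φ - 1) * (x + y)) + (4 * φ + 2) * (a + x) ≤ (4 * φ + 2) * a ∧
    -((φ - 1) * (x + y)) + (4 * φ + 2) * (b + y) ≤ (4 * φ + 2) * a ∧
    -((φ - 1) * (x + y)) + (4 * φ + 2) * (((φ - 1) * b - a) + ((φ - 1) * y - x)) ≤ (4 * φ + 2) * a ∧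
    -((φ - 1) * (x + y)) + (4 * φ + 2) * ((-((φ - 1) * (a + b))) + (-((φ - 1) * (x + y)))) ≤
      (4 * φ + 2) * a := by
  have g1 := Real.one_lt_goldenRatio
  have r2 : ∀ z : ℝ, φ * (φ * z) = φ * z + z := fun z => by
    linear_combination z * Real.goldenRatio_sq
  have r3 : ∀ z : ℝ, φ * (φ * (φ * z)) = 2 * (φ * z) + z := fun z => by
    linear_combination (φ * z + z) * Real.goldenRatio_sq
  have scale : ∀ {k z : ℝ}, 0 ≤ k → 0 ≤ z → 0 ≤ k * z := fun hk hz => mul_nonneg hk hz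
  refine ⟨?_, ?_, ?_, ?_⟩
  · linarith [r2 a, r3 a, r2 b, r3 b, r2 x, r3 x, r2 y, r3 y,
      scale (k := φ) (by linarith) p32,
      scale (k := 3 * φ + 2) (by linarith) p34]
  · linarith [r2 a, r3 a, r2 b, r3 b, r2 x, r3 x, r2 y, r3 y,
      scale (k := φ) (by linarith) p34,
      scale (k := 4 * φ + 2) (by linarith) w01,
      scale (k := 3 * φ + 2) (by linarith) p32]
  · linarith [r2 a, r3 a, r2 b, r3 b, r2 x, r3 x, r2 y, r3 y,
      scale (k := 4 * φ + 2) (by linarith) p32,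
      scale (k := 4 * φ + 3) (by linarith) pw,
      scale (k := 5 * φ + 3) (by linarith) w01]
  · linarith [r2 a, r3 a, r2 b, r3 b, r2 x, r3 x, r2 y, r3 y,
      scale (k := φ) (by linarith) w32,
      scale (k := 3 * φ + 2) (by linarith) w34,
      scale (k := 4 * φ + 3) (by linarith) pw]

/-- The two obstructions themselves, `A1` and `B4`, supply what is needed to bound all five
components after both steps. -/
theorem double_step_bound {a b s t x y : ℝ}
    (w01 : 0 ≤ a - b)
    (w32 : 0 ≤ ((φ - 1) * b - a) - (-((φ - 1) * (a + b))))
    (w34 : 0 ≤ ((φ - 1) * a - b) - (-((φ - 1) * (a + b))))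
    (w03 : 0 ≤ (φ - 1) * (a + b) - a)
    (v01 : 0 ≤ s - t)
    (v04 : 0 ≤ s - ((φ - 1) * s - t))
    (vw : 0 ≤ a - s)
    (p34 : 0 ≤ (-((φ - 1) * (x + y))) - ((φ - 1) * x - y))
    (pw : 0 ≤ (φ - 1) * (a + b) - (-((φ - 1) * (x + y))))
    (p3 : 0 ≤ (-((φ - 1) * (x + y))))
    (A1 : 0 ≤ s + (4 * φ + 2) * (b - t) - (4 * φ + 2) * a)
    (B4 : 0 ≤ -((φ - 1) * (x + y)) + (4 * φ + 2) * (((φ - 1) * a - b) + ((φ - 1) * x - y)) -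
      (4 * φ + 2) * a) :
    s + (-((φ - 1) * (x + y))) + (4 * φ + 2) * (s - (a + x)) ≤
      (4 * φ + 2) * a ∧
    s + (-((φ - 1) * (x + y))) + (4 * φ + 2) * (t - (b + y)) ≤
      (4 * φ + 2) * a ∧
    s + (-((φ - 1) * (x + y))) +
      (4 * φ + 2) * (((φ - 1) * t - s) - (((φ - 1) * b - a) + ((φ - 1) * y - x))) ≤
      (4 * φ + 2) * a ∧
    s + (-((φ - 1) * (x + y))) +
      (4 * φ + 2) * ((-((φ - 1) * (s + t))) - ((-((φ - 1) * (a + b))) + (-((φ - 1) * (x + y))))) ≤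
      (4 * φ + 2) * a ∧
    s + (-((φ - 1) * (x + y))) +
      (4 * φ + 2) * (((φ - 1) * s - t) - (((φ - 1) * a - b) + ((φ - 1) * x - y))) ≤
      (4 * φ + 2) * a := by
  have g1 := Real.one_lt_goldenRatio
  have r2 : ∀ z : ℝ, φ * (φ * z) = φ * z + z := fun z => by
    linear_combination z * Real.goldenRatio_sq
  have r3 : ∀ z : ℝ, φ * (φ * (φ * z)) = 2 * (φ * z) + z := fun z => by
    linear_combination (φ * z + z) * Real.goldenRatio_sq
  have scale : ∀ {k z : ℝ}, 0 ≤ k → 0 ≤ z → 0 ≤ k * z := fun hk hz => mul_nonneg hk hz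
  refine ⟨?_, ?_, ?_, ?_, ?_⟩
  · linarith [r2 a, r3 a, r2 b, r3 b, r2 s, r3 s, r2 t, r3 t,
      r2 x, r3 x, r2 y, r3 y,
      scale (k := 4 * φ + 3) (by linarith) vw,
      scale (k := φ + 1) (by linarith) w34,
      scale (k := φ - 1) (by linarith) B4,
      scale (k := 5 * φ + 2) (by linarith) pw]
  · linarith [r2 a, r3 a, r2 b, r3 b, r2 s, r3 s, r2 t, r3 t,
      r2 x, r3 x, r2 y, r3 y,
      scale (k := 2 * φ) (by linarith) w03,
      scale (k := 5 * φ + 1) (by linarith) w01,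
      scale (k := 2) (by linarith) vw,
      scale (k := 1) (by linarith) A1,
      scale (k := 4 * φ + 5) (by linarith) pw,
      scale (k := 2 * φ + 2) (by linarith) p34]
  · linarith [r2 a, r3 a, r2 b, r3 b, r2 s, r3 s, r2 t, r3 t,
      r2 x, r3 x, r2 y, r3 y,
      scale (k := 2 * φ + 1) (by linarith) pw,
      scale (k := 4 * φ + 2) (by linarith) p34,
      scale (k := 6 * φ + 4) (by linarith) v04,
      scale (k := 7 * φ + 5) (by linarith) w01,
      scale (k := 2 * φ - 1) (by linarith) A1]
  · linarith [r2 a, r3 a, r2 b, r3 b, r2 s, r3 s, r2 t, r3 t,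
      r2 x, r3 x, r2 y, r3 y,
      scale (k := 6 * φ + 4) (by linarith) pw,
      scale (k := 6 * φ + 4) (by linarith) p34,
      scale (k := φ) (by linarith) v01,
      scale (k := 3 * φ + 2) (by linarith) v04,
      scale (k := 3 * φ + 1) (by linarith) p3,
      scale (k := φ) (by linarith) B4]
  · linarith [r2 a, r3 a, r2 b, r3 b, r2 s, r3 s, r2 t, r3 t,
      r2 x, r3 x, r2 y, r3 y,
      scale (k := 4 * φ + 3) (by linarith) vw,
      scale (k := 3 * φ + 1) (by linarith) w32,
      scale (k := 4 * φ + 2) (by linarith) w01,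
      scale (k := 4 * φ + 2) (by linarith) v04,
      scale (k := 2) (by linarith) pw,
      scale (k := 1) (by linarith) B4]

/-- Two points whose coordinate families are `w` and `0` can be brought closer together, relative to
the cost of the steps, by stepping from `0` to `v`, or from `w` to `w + p`, or both. -/
theorem step_trichotomy {w v p : ZMod 5 → ℝ} (hw : IsPentagonal w) (hv : IsPentagonal v)
    (hp : IsPentagonal p) (w0 : ∀ j, w j ≤ w 0) (w3 : ∀ j, w 3 ≤ w j) (w03 : w 0 ≤ -w 3)
    (v0 : ∀ j, v j ≤ v 0) (vw : v 0 ≤ w 0) (p3 : ∀ j, p j ≤ p 3) (pw : p 3 ≤ -w 3)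
    (v_nonneg : 0 ≤ v 0) (p_nonneg : 0 ≤ p 3) :
    (∀ j, v 0 + (4 * φ + 2) * (w j - v j) ≤ (4 * φ + 2) * w 0) ∨
    (∀ j, p 3 + (4 * φ + 2) * (w j + p j) ≤ (4 * φ + 2) * w 0) ∨
    ∀ j, v 0 + p 3 + (4 * φ + 2) * (v j - (w j + p j)) ≤ (4 * φ + 2) * w 0 := by
  have hj : ∀ j : ZMod 5, j = 0 ∨ j = 1 ∨ j = 2 ∨ j = 3 ∨ j = 4 := by decide
  have w01 := sub_nonneg.2 (w0 1)
  have w04 := sub_nonneg.2 (w0 4)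
  have w32 := sub_nonneg.2 (w3 2)
  have w34 := sub_nonneg.2 (w3 4)
  have w03' := sub_nonneg.2 w03
  have v01 := sub_nonneg.2 (v0 1)
  have v04 := sub_nonneg.2 (v0 4)
  have vw' := sub_nonneg.2 vw
  have p32 := sub_nonneg.2 (p3 2)
  have p34 := sub_nonneg.2 (p3 4)
  have pw' := sub_nonneg.2 pw
  by_cases A1 : v 0 + (4 * φ + 2) * (w 1 - v 1) ≤ (4 * φ + 2) * w 0
  · left
    simp only [hw.apply_two, hw.apply_three, hw.apply_four, hv.apply_four, neg_neg] at *
    obtain ⟨h0, h2, h3, h4⟩ := source_step_bound w01 w34 w04 w03' v01 v04 vw' v_nonneg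
    intro j
    rcases hj j with rfl | rfl | rfl | rfl | rfl <;>
      simpa only [hw.apply_two, hw.apply_three, hw.apply_four, hv.apply_two, hv.apply_three,
        hv.apply_four]
  by_cases B4 : p 3 + (4 * φ + 2) * (w 4 + p 4) ≤ (4 * φ + 2) * w 0
  · right; left
    simp only [hw.apply_two, hw.apply_three, hw.apply_four, hp.apply_two, hp.apply_three,
      hp.apply_four, neg_neg] at *
    obtain ⟨h0, h1, h2, h3⟩ := target_step_bound w01 w32 w34 p32 p34 pw'
    intro j
    rcases hj j with rfl | rfl | rfl | rfl | rfl <;>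
      simpa only [hw.apply_two, hw.apply_three, hw.apply_four, hp.apply_two, hp.apply_three,
        hp.apply_four]
  · right; right
    replace A1 := sub_nonneg.2 (not_le.1 A1).le
    replace B4 := sub_nonneg.2 (not_le.1 B4).le
    simp only [hw.apply_two, hw.apply_three, hw.apply_four, hv.apply_four, hp.apply_two,
      hp.apply_three, hp.apply_four, neg_neg] at *
    obtain ⟨h0, h1, h2, h3, h4⟩ :=
      double_step_bound w01 w32 w34 w03' v01 v04 vw' p34 pw' p_nonneg A1 B4
    intro j
    rcases hj j with rfl | rfl | rfl | rfl | rfl <;>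
      simpa only [hw.apply_two, hw.apply_three, hw.apply_four, hv.apply_two, hv.apply_three,
        hv.apply_four, hp.apply_two, hp.apply_three, hp.apply_four]

/-! ### The pentagonal gauge and the cones. -/

theorem inner_clockDir (θ : ℝ) (x : Plane) :
    inner ℝ (clockDir θ) x = Real.sin θ * x 0 + Real.cos θ * x 1 := by
  simp [clockDir, PiLp.inner_apply, Fin.sum_univ_two, mul_comm]

theorem norm_clockDir (θ : ℝ) : ‖clockDir θ‖ = 1 := by
  rw [← sq_eq_sq₀ (norm_nonneg _) zero_le_one, EuclideanSpace.real_norm_sq_eq]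
  simp [clockDir, Fin.sum_univ_two]

theorem cos_pi_div_five_eq : Real.cos (Real.pi / 5) = φ / 2 := by
  rw [Real.cos_pi_div_five, Real.goldenRatio]
  ring

theorem two_mul_cos_two_pi_div_five : 2 * Real.cos (2 * Real.pi / 5) = φ - 1 := by
  rw [show 2 * Real.pi / 5 = 2 * (Real.pi / 5) by ring, Real.cos_two_mul, cos_pi_div_five_eq]
  linear_combination Real.goldenRatio_sq

theorem bisectorDir_add_five (n : ℕ) : bisectorDir 5 (n + 5) = bisectorDir 5 n := by
  simp only [bisectorDir, clockDir]
  rw [show 2 * Real.pi * ((n + 5 : ℕ) : ℝ) / ((5 : ℕ) : ℝ)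
    = 2 * Real.pi * (n : ℝ) / ((5 : ℕ) : ℝ) + 2 * Real.pi by push_cast; ring]
  rw [Real.sin_add_two_pi, Real.cos_add_two_pi]

theorem bisectorDir_mod_five (n : ℕ) : bisectorDir 5 (n % 5) = bisectorDir 5 n :=
  Function.Periodic.map_mod_nat bisectorDir_add_five n

/-- The projection on the bisector of the cone `C_i`, in units in which the boundaries of the
canonical triangle have length `1` when the projection is `1`. -/
def pentagonForm (i : ZMod 5) (x : Plane) : ℝ :=
  inner ℝ (bisectorDir 5 i.val) x / Real.cos (Real.pi / 5)

theorem pentagonForm_natCast (n : ℕ) (x : Plane) :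
    pentagonForm n x = inner ℝ (bisectorDir 5 n) x / Real.cos (Real.pi / 5) := by
  rw [pentagonForm, ZMod.val_natCast, bisectorDir_mod_five]

theorem pentagonForm_sub (i : ZMod 5) (x y : Plane) :
    pentagonForm i (x - y) = pentagonForm i x - pentagonForm i y := by
  simp only [pentagonForm, inner_sub_right, sub_div]

theorem isPentagonal_pentagonForm (x : Plane) : IsPentagonal fun i => pentagonForm i x := by
  intro i
  obtain ⟨n, rfl⟩ : ∃ n : ℕ, ((n + 1 : ℕ) : ZMod 5) = i :=
    ⟨(i - 1).val, by rw [Nat.cast_add, ZMod.natCast_zmod_val]; simp⟩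
  rw [show ((n + 1 : ℕ) : ZMod 5) - 1 = (n : ℕ) by push_cast; ring,
    show ((n + 1 : ℕ) : ZMod 5) + 1 = (n + 2 : ℕ) by push_cast; ring]
  simp only [pentagonForm_natCast, bisectorDir, inner_clockDir]
  rw [← two_mul_cos_two_pi_div_five]
  set θ := 2 * Real.pi * ((n + 1 : ℕ) : ℝ) / ((5 : ℕ) : ℝ) with hθ
  set δ := 2 * Real.pi / 5 with hδ
  rw [show 2 * Real.pi * (n : ℝ) / ((5 : ℕ) : ℝ) = θ - δ by rw [hθ, hδ]; push_cast; ring,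
    show 2 * Real.pi * ((n + 2 : ℕ) : ℝ) / ((5 : ℕ) : ℝ) = θ + δ by
      rw [hθ, hδ]; push_cast; ring]
  rw [Real.sin_add, Real.sin_sub, Real.cos_add, Real.cos_sub]
  ring

/-- The distance function whose unit ball is the regular pentagon with vertices on the boundaries of
the five cones, at distance `1`: the length of a leg of the canonical triangle. -/
def pentagonGauge (x : Plane) : ℝ :=
  Finset.univ.sup' Finset.univ_nonempty fun i => pentagonForm i x

theorem pentagonForm_le_gauge (i : ZMod 5) (x : Plane) : pentagonForm i x ≤ pentagonGauge x :=
  Finset.le_sup' (fun i => pentagonForm i x) (Finset.mem_univ i)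

theorem exists_pentagonGauge_eq (x : Plane) : ∃ i, pentagonGauge x = pentagonForm i x := by
  obtain ⟨i, -, hi⟩ := Finset.exists_mem_eq_sup' Finset.univ_nonempty
    fun i : ZMod 5 => pentagonForm i x
  exact ⟨i, hi⟩

/-- In the cone `C_i` the largest of the five projections is the one on the bisector of `C_i`, and
it bounds the distance from the apex. -/
theorem gauge_eq_of_mem_cone {i : ℕ} {a x : Plane} (hx : x ∈ cone 5 i a) :
    pentagonGauge (x - a) = pentagonForm i (x - a) ∧ dist a x ≤ pentagonGauge (x - a) := by
  obtain ⟨r, t, hr, h1, h2, rfl⟩ := hx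
  have hpi := Real.pi_pos
  have hC : 0 < Real.cos (Real.pi / 5) := by
    rw [cos_pi_div_five_eq]
    exact half_pos Real.goldenRatio_pos
  push_cast at h1 h2
  have form : ∀ n : ℕ, pentagonForm n (a + r • clockDir t - a) =
      r * Real.cos (t - 2 * Real.pi * n / 5) / Real.cos (Real.pi / 5) := by
    intro n
    rw [pentagonForm_natCast, bisectorDir, inner_clockDir, add_sub_cancel_left, Real.cos_sub]
    simp [clockDir]
    ring
  have le_form : ∀ j : ZMod 5, pentagonForm j (a + r • clockDir t - a) ≤
      pentagonForm i (a + r • clockDir t - a) := by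
    intro j
    obtain ⟨k, rfl, hk⟩ : ∃ k : ℕ, ((i + k : ℕ) : ZMod 5) = j ∧ k < 5 :=
      ⟨(j - i).val, by rw [Nat.cast_add, ZMod.natCast_zmod_val]; simp, ZMod.val_lt _⟩
    rw [form, form, div_le_div_iff_of_pos_right hC]
    refine mul_le_mul_of_nonneg_left ?_ hr.le
    rw [← sub_nonneg, Real.cos_sub_cos]
    rcases Nat.eq_zero_or_pos k with rfl | hk0
    · simp
    have hk1 : (1 : ℝ) ≤ k := by exact_mod_cast hk0
    have hk4 : (k : ℝ) ≤ 4 := by exact_mod_cast Nat.le_of_lt_succ hk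
    have hlo := mul_le_mul_of_nonneg_left hk1 hpi.le
    have hhi := mul_le_mul_of_nonneg_left hk4 hpi.le
    -- With `A = t - 2πi/5` in `[-π/5, π/5]`, the half-sum is `A - πk/5`, in `[-π, 0]`, and the
    -- half-difference is `πk/5`, in `[0, π]`.
    have s1 :
        Real.sin ((t - 2 * Real.pi * i / 5 + (t - 2 * Real.pi * (i + k : ℕ) / 5)) / 2) ≤ 0 := by
      apply Real.sin_nonpos_of_nonpos_of_neg_pi_le <;> push_cast <;> linarith
    have s2 :
        0 ≤ Real.sin ((t - 2 * Real.pi * i / 5 - (t - 2 * Real.pi * (i + k : ℕ) / 5)) / 2) := by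
      apply Real.sin_nonneg_of_nonneg_of_le_pi <;> push_cast <;> linarith
    nlinarith [mul_nonneg (neg_nonneg.2 s1) s2]
  have gauge_eq : pentagonGauge (a + r • clockDir t - a) =
      pentagonForm i (a + r • clockDir t - a) :=
    le_antisymm (Finset.sup'_le _ _ fun j _ => le_form j) (pentagonForm_le_gauge _ _)
  refine ⟨gauge_eq, ?_⟩
  rw [gauge_eq, form, le_div_iff₀ hC, dist_eq_norm, sub_add_cancel_left, norm_neg, norm_smul,
    norm_clockDir, mul_one, Real.norm_of_nonneg hr.le]
  refine mul_le_mul_of_nonneg_left ?_ hr.le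
  rw [← Real.cos_abs (t - _)]
  refine Real.cos_le_cos_of_nonneg_of_le_pi (abs_nonneg _) (by linarith) ?_
  rw [abs_le]
  constructor <;> linarith

theorem exists_mem_cone {a x : Plane} (h : x ≠ a) : ∃ i < 5, x ∈ cone 5 i a := by
  have hpi := Real.pi_pos
  -- The coordinates are swapped so that `z.arg` is the clockwise angle from the positive `y`-axis.
  -- Cones 3 and 4 have angles beyond `π`, hence the shift by `2π` in `key1`.
  set z : ℂ := ⟨(x - a) 1, (x - a) 0⟩ with hz
  have hz0 : z ≠ 0 := by
    intro h0
    apply h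
    rw [← sub_eq_zero]
    have h1 := congrArg Complex.re h0
    have h2 := congrArg Complex.im h0
    ext i
    fin_cases i
    · exact h2
    · exact h1
  have key : ∀ t : ℝ, Real.sin t = Real.sin z.arg → Real.cos t = Real.cos z.arg →
      x = a + ‖z‖ • clockDir t := by
    intro t hs hc
    rw [← sub_eq_iff_eq_add']
    ext i
    fin_cases i
    · simp [clockDir, hs, Complex.norm_mul_sin_arg, hz]
    · simp [clockDir, hc, Complex.norm_mul_cos_arg, hz]
  have hr : 0 < ‖z‖ := norm_pos_iff.2 hz0
  have l1 := Complex.neg_pi_lt_arg z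
  have l2 := Complex.arg_le_pi z
  have key0 := key z.arg rfl rfl
  have key1 := key (z.arg + 2 * Real.pi) (Real.sin_add_two_pi _) (Real.cos_add_two_pi _)
  by_cases c3 : z.arg ≤ -(3 * Real.pi / 5)
  · exact ⟨3, by norm_num, ‖z‖, _, hr, by push_cast; linarith, by push_cast; linarith, key1⟩
  by_cases c4 : z.arg ≤ -(Real.pi / 5)
  · refine ⟨4, by norm_num, ‖z‖, _, hr, ?_, ?_, key1⟩ <;> push_cast <;> linarith
  by_cases c0 : z.arg ≤ Real.pi / 5
  · refine ⟨0, by norm_num, ‖z‖, _, hr, ?_, ?_, key0⟩ <;> push_cast <;> linarith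
  by_cases c1 : z.arg ≤ 3 * Real.pi / 5
  · refine ⟨1, by norm_num, ‖z‖, _, hr, ?_, ?_, key0⟩ <;> push_cast <;> linarith
  · refine ⟨2, by norm_num, ‖z‖, _, hr, ?_, ?_, key0⟩ <;> push_cast <;> linarith

/-! ### Comparison with the Euclidean norm. -/

/-- Cauchy–Schwarz: bisectors two indices apart differ by a vector of squared length `2 + φ`, and
`(2(φ + 1))² * (2 + φ) = 28 + 44φ = 50 + 22√5`. -/
theorem sq_pentagonForm_sub_le (i : ZMod 5) (x : Plane) :
    ((2 * φ + 1) * (pentagonForm i x - pentagonForm (i + 2) x)) ^ 2 ≤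
      (50 + 22 * Real.sqrt 5) * ‖x‖ ^ 2 := by
  obtain ⟨n, rfl⟩ : ∃ n : ℕ, (n : ZMod 5) = i := ⟨i.val, ZMod.natCast_zmod_val i⟩
  rw [show (n : ZMod 5) + 2 = (n + 2 : ℕ) by push_cast; ring]
  simp only [pentagonForm_natCast, bisectorDir, inner_clockDir]
  set θ := 2 * Real.pi * (n : ℝ) / ((5 : ℕ) : ℝ) with hθ
  set η := 2 * Real.pi * ((n + 2 : ℕ) : ℝ) / ((5 : ℕ) : ℝ) with hη
  have hcos : Real.cos η * Real.cos θ + Real.sin η * Real.sin θ = -(φ / 2) := by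
    rw [← Real.cos_sub, ← cos_pi_div_five_eq, ← Real.cos_pi_sub, hθ, hη]
    congr 1
    push_cast
    ring
  have hnorm : ‖x‖ ^ 2 = x 0 ^ 2 + x 1 ^ 2 := by
    rw [EuclideanSpace.real_norm_sq_eq, Fin.sum_univ_two]
  have h5 : 50 + 22 * Real.sqrt 5 = 28 + 44 * φ := by
    rw [Real.goldenRatio]
    ring
  have hφ := Real.goldenRatio_pos
  have hsq := Real.goldenRatio_sq
  have hone1 := Real.sin_sq_add_cos_sq θ
  have hone2 := Real.sin_sq_add_cos_sq η
  have cauchy : ((Real.sin θ - Real.sin η) * x 0 + (Real.cos θ - Real.cos η) * x 1) ^ 2 ≤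
      (2 + φ) * (x 0 ^ 2 + x 1 ^ 2) := by
    have h : (Real.sin θ - Real.sin η) ^ 2 + (Real.cos θ - Real.cos η) ^ 2 = 2 + φ := by
      linear_combination hone1 + hone2 - 2 * hcos
    rw [← h]
    nlinarith [sq_nonneg ((Real.sin θ - Real.sin η) * x 1 - (Real.cos θ - Real.cos η) * x 0)]
  rw [cos_pi_div_five_eq, hnorm, h5]
  have hfac : (2 * φ + 1) / (φ / 2) = 2 * (φ + 1) := by
    rw [div_eq_iff (by positivity)]
    linear_combination (-1 : ℝ) * hsq
  calc _ = ((2 * φ + 1) / (φ / 2)) ^ 2 *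
        ((Real.sin θ - Real.sin η) * x 0 + (Real.cos θ - Real.cos η) * x 1) ^ 2 := by ring
    _ ≤ (2 * (φ + 1)) ^ 2 * ((2 + φ) * (x 0 ^ 2 + x 1 ^ 2)) := by
      rw [hfac]
      exact mul_le_mul_of_nonneg_left cauchy (sq_nonneg _)
    _ = (28 + 44 * φ) * (x 0 ^ 2 + x 1 ^ 2) := by
      linear_combination (4 * φ + 20) * (x 0 ^ 2 + x 1 ^ 2) * hsq

theorem pentagonForm_neg (i : ZMod 5) (x : Plane) : pentagonForm i (-x) = -pentagonForm i x := by
  simp only [pentagonForm, inner_neg_right, neg_div]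

theorem min_opposite {f : ZMod 5 → ℝ} (hf : IsPentagonal f) {i k : ZMod 5}
    (hi : ∀ j, f j ≤ f i) (hk : ∀ j, f k ≤ f j) : k = i + 2 ∨ k = i + 3 ∨ f i = 0 := by
  have h := (hf.shift i).min_opposite_zero (k := k - i) (by simpa using fun j => hi (i + j))
    (by simpa using fun j => hk (i + j))
  simpa [sub_eq_iff_eq_add'] using h

/-- The minimum is at most the mean of the two gauges, which is half the difference of the largest
and smallest projections. These lie on bisectors two indices apart in the cyclic order, unless the
gauge of `x` vanishes. -/
theorem min_gauge_le (x : Plane) :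
    (4 * φ + 2) * min (pentagonGauge x) (pentagonGauge (-x)) ≤
      Real.sqrt (50 + 22 * Real.sqrt 5) * ‖x‖ := by
  have hφ := Real.goldenRatio_pos
  obtain ⟨i, hi⟩ := exists_pentagonGauge_eq x
  obtain ⟨k, hk⟩ := exists_pentagonGauge_eq (-x)
  have chord : ∀ i : ZMod 5, |(2 * φ + 1) * (pentagonForm i x - pentagonForm (i + 2) x)| ≤
      Real.sqrt (50 + 22 * Real.sqrt 5) * ‖x‖ := by
    intro i
    refine abs_le_of_sq_le_sq ?_ (by positivity)
    rw [mul_pow (Real.sqrt _), Real.sq_sqrt (by positivity)]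
    exact sq_pentagonForm_sub_le i x
  have hmin : (4 * φ + 2) * min (pentagonGauge x) (pentagonGauge (-x)) ≤
      (2 * φ + 1) * (pentagonForm i x - pentagonForm k x) := by
    rw [hi, hk, pentagonForm_neg]
    nlinarith [min_le_left (pentagonForm i x) (-pentagonForm k x),
      min_le_right (pentagonForm i x) (-pentagonForm k x)]
  rcases min_opposite (isPentagonal_pentagonForm x) (i := i) (k := k)
    (fun j => hi ▸ pentagonForm_le_gauge j x)
    (fun j => by
      have := pentagonForm_le_gauge j (-x)
      rw [hk, pentagonForm_neg, pentagonForm_neg] at this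
      linarith) with rfl | rfl | h0
  · exact hmin.trans ((le_abs_self _).trans (chord i))
  · refine hmin.trans ((le_abs_self _).trans ?_)
    have h := chord (i + 3)
    rw [show i + 3 + 2 = i by rw [add_assoc, show (3 + 2 : ZMod 5) = 0 by decide, add_zero]] at h
    rwa [← abs_neg, ← mul_neg, neg_sub]
  · have : min (pentagonGauge x) (pentagonGauge (-x)) ≤ 0 :=
      (min_le_left _ _).trans (by rw [hi, h0])
    have h2 : 0 ≤ Real.sqrt (50 + 22 * Real.sqrt 5) * ‖x‖ := by positivity
    nlinarith

/-! ### Walk lengths. -/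

section Walk

variable {P : Finset Plane} {G : SimpleGraph P} {u v w : P}

theorem walkLength_nil : walkLength (SimpleGraph.Walk.nil : G.Walk u u) = 0 := by
  simp [walkLength]

theorem walkLength_cons (h : G.Adj u v) (p : G.Walk v w) :
    walkLength (SimpleGraph.Walk.cons h p) = dist (u : Plane) v + walkLength p := by
  simp [walkLength]

theorem walkLength_reverse (p : G.Walk u v) : walkLength p.reverse = walkLength p := by
  simp only [walkLength, SimpleGraph.Walk.darts_reverse, List.map_reverse, List.sum_reverse,
    List.map_map]
  congr 1
  refine List.map_congr_left fun d _ => ?_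
  exact dist_comm _ _

theorem walkLength_bypass_le (p : G.Walk u v) : walkLength p.bypass ≤ walkLength p := by
  refine (p.darts_bypass_sublist_darts.map _).sum_le_sum fun x hx => ?_
  obtain ⟨d, -, rfl⟩ := List.mem_map.1 hx
  exact dist_nonneg

end Walk

/-! ### Steps along edges of the theta graph. -/

theorem exists_thetaGraph_adj {P : Finset Plane} {u x : P} (h : x ≠ u) :
    ∃ i : ZMod 5, pentagonGauge (x - u : Plane) = pentagonForm i (x - u) ∧
      ∃ v : P, (thetaGraph 5 P).Adj u v ∧ 0 < pentagonGauge (v - u : Plane) ∧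
        dist (u : Plane) v ≤ pentagonGauge (v - u : Plane) ∧
        pentagonGauge (v - u : Plane) = pentagonForm i (v - u) ∧
        pentagonGauge (v - u : Plane) ≤ pentagonGauge (x - u : Plane) := by
  classical
  have hxu : (x : Plane) ≠ u := fun e => h (Subtype.ext e)
  obtain ⟨i, hi, hx⟩ := exists_mem_cone hxu
  obtain ⟨v, hv, hmin⟩ := (P.filter (· ∈ cone 5 i (u : Plane))).exists_min_image
    (fun y => bisectorProj 5 i u y) ⟨x, Finset.mem_filter.2 ⟨x.2, hx⟩⟩
  rw [Finset.mem_filter] at hv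
  obtain ⟨gx, -⟩ := gauge_eq_of_mem_cone hx
  obtain ⟨gv, dv⟩ := gauge_eq_of_mem_cone hv.2
  have hvu : v ≠ u := by
    rintro rfl
    obtain ⟨r, t, hr, -, -, e⟩ := hv.2
    have h0 := norm_clockDir t
    rw [left_eq_add, smul_eq_zero] at e
    rcases e with e | e
    · exact hr.ne' e
    · simp [e] at h0
  refine ⟨i, gx, ⟨v, hv.1⟩, ?_, (dist_pos.2 hvu.symm).trans_le dv, dv, gv, ?_⟩
  · rw [thetaGraph, SimpleGraph.fromRel_adj]
    refine ⟨fun e => hvu (congrArg Subtype.val e).symm, Or.inl ⟨i, hi, hv.1, hv.2, ?_⟩⟩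
    exact fun y hy hyc => hmin y (Finset.mem_filter.2 ⟨hy, hyc⟩)
  · have hC : 0 ≤ Real.cos (Real.pi / 5) := by
      rw [cos_pi_div_five_eq]
      exact (half_pos Real.goldenRatio_pos).le
    rw [gx, gv, pentagonForm_natCast, pentagonForm_natCast]
    exact div_le_div_of_nonneg_right (hmin x (Finset.mem_filter.2 ⟨x.2, hx⟩)) hC

/-- Relabelling puts the maximum at 0 and the minimum at 3: a rotation when `k = i + 3`, a
reflection when `k = i + 2`. -/
theorem exists_symmetry {i k : ZMod 5} (h : k = i + 2 ∨ k = i + 3) :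
    ∃ e : ZMod 5 ≃ ZMod 5, e 0 = i ∧ e 3 = k ∧
      ∀ f : ZMod 5 → ℝ, IsPentagonal f → IsPentagonal fun j => f (e j) := by
  rcases h with rfl | rfl
  · refine ⟨Equiv.subLeft i, by simp, ?_, fun f hf => hf.reflect i⟩
    rw [Equiv.subLeft_apply, sub_eq_iff_eq_add, add_assoc, show (2 + 3 : ZMod 5) = 0 by decide,
      add_zero]
  · exact ⟨Equiv.addLeft i, by simp, by simp, fun f hf => hf.shift i⟩

/-- The source `u` can step to `v`, or the target `w` to `q`, or both, at a cost that is made up for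
by the decrease of the gauge. -/
theorem exists_step {P : Finset Plane} {u w : P} (h : w ≠ u)
    (hle : pentagonGauge (w - u : Plane) ≤ pentagonGauge (u - w : Plane)) :
    ∃ v q : P, (thetaGraph 5 P).Adj u v ∧ (thetaGraph 5 P).Adj w q ∧
      ∃ a b : ℝ, 0 < a ∧ 0 < b ∧ dist (u : Plane) v ≤ a ∧ dist (w : Plane) q ≤ b ∧
        (a + (4 * φ + 2) * pentagonGauge (w - v : Plane) ≤
            (4 * φ + 2) * pentagonGauge (w - u : Plane) ∨
          b + (4 * φ + 2) * pentagonGauge (q - u : Plane) ≤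
            (4 * φ + 2) * pentagonGauge (w - u : Plane) ∨
          a + b + (4 * φ + 2) * pentagonGauge (v - q : Plane) ≤
            (4 * φ + 2) * pentagonGauge (w - u : Plane)) := by
  obtain ⟨i, hi, v, huv, v_pos, dv, gv, gvw⟩ := exists_thetaGraph_adj h
  obtain ⟨k, hk, q, hwq, q_pos, dq, gq, gqu⟩ := exists_thetaGraph_adj h.symm
  refine ⟨v, q, huv, hwq, _, _, v_pos, q_pos, dv, dq, ?_⟩
  have hneg : ∀ j, pentagonForm j (u - w : Plane) = -pentagonForm j (w - u) := fun j => by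
    rw [← pentagonForm_neg, neg_sub]
  have hmax : ∀ j, pentagonForm j (w - u : Plane) ≤ pentagonForm i (w - u) :=
    fun j => hi ▸ pentagonForm_le_gauge j _
  have hmin : ∀ j, pentagonForm k (w - u : Plane) ≤ pentagonForm j (w - u) := fun j => by
    have := hk ▸ pentagonForm_le_gauge j (u - w : Plane)
    rw [hneg, hneg] at this
    linarith
  have hopp : k = i + 2 ∨ k = i + 3 := by
    rcases min_opposite (isPentagonal_pentagonForm (w - u)) hmax hmin with h1 | h1 | h1
    · exact Or.inl h1
    · exact Or.inr h1
    · rw [hi, h1] at gvw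
      exact absurd v_pos gvw.not_gt
  obtain ⟨e, rfl, rfl, he⟩ := exists_symmetry hopp
  have bound : ∀ {x : Plane} {s t : ℝ},
      (∀ j, s + (4 * φ + 2) * pentagonForm (e j) x ≤ t) →
        s + (4 * φ + 2) * pentagonGauge x ≤ t := by
    intro x s t hx
    obtain ⟨j, hj⟩ := exists_pentagonGauge_eq x
    simpa [hj] using hx (e.symm j)
  have sub_form : ∀ (j : ZMod 5) (x y : Plane), pentagonForm j x - pentagonForm j y =
    pentagonForm j (x - y) := fun j x y => (pentagonForm_sub j x y).symm
  have add_form : ∀ (j : ZMod 5) (x y : Plane), pentagonForm j x + pentagonForm j y =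
    pentagonForm j (x + y) := fun j x y => by
      rw [← sub_neg_eq_add x y, pentagonForm_sub, pentagonForm_neg, sub_neg_eq_add]
  have key := step_trichotomy (he _ (isPentagonal_pentagonForm (w - u : Plane)))
    (he _ (isPentagonal_pentagonForm (v - u : Plane)))
    (he _ (isPentagonal_pentagonForm (q - w : Plane))) (fun j => hmax (e j)) (fun j => hmin (e j))
    (by rwa [hi, hk, hneg] at hle) (fun j => gv ▸ pentagonForm_le_gauge _ _)
    (by rwa [gv, hi] at gvw) (fun j => gq ▸ pentagonForm_le_gauge _ _)
    (by rwa [gq, hk, hneg] at gqu) (gv ▸ v_pos.le) (gq ▸ q_pos.le)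
  simp only [sub_form, add_form, ← gv, ← gq, ← hi] at key
  rw [show (w - u - (v - u) : Plane) = w - v by abel,
    show (w - u + (q - w) : Plane) = q - u by abel,
    show (v - u - (q - u) : Plane) = v - q by abel] at key
  exact key.imp bound (Or.imp bound bound)

/-! ### Induction on the gauge, and the spanning ratio. -/

theorem exists_walk_le_gauge (P : Finset Plane) (u w : P) :
    ∃ p : (thetaGraph 5 P).Walk u w,
      walkLength p ≤ (4 * φ + 2) * pentagonGauge (w - u : Plane) := by
  have hφ := Real.goldenRatio_pos
  have hc : 0 < 4 * φ + 2 := by linarith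
  let r : P × P → P × P → Prop := fun x y =>
    pentagonGauge (x.2 - x.1 : Plane) < pentagonGauge (y.2 - y.1 : Plane)
  have : IsTrans (P × P) r := ⟨fun _ _ _ => lt_trans⟩
  have : Std.Irrefl r := ⟨fun _ => lt_irrefl _⟩
  suffices H : ∀ x : P × P, ∃ p : (thetaGraph 5 P).Walk x.1 x.2,
      walkLength p ≤ (4 * φ + 2) * pentagonGauge (x.2 - x.1 : Plane) from H (u, w)
  intro x
  induction x using (Finite.wellFounded_of_trans_of_irrefl r).induction with
  | _ x ih =>
  obtain ⟨u, w⟩ := x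
  have ih' : ∀ a b : P, (4 * φ + 2) * pentagonGauge (b - a : Plane) <
      (4 * φ + 2) * pentagonGauge (w - u : Plane) → ∃ p : (thetaGraph 5 P).Walk a b,
      walkLength p ≤ (4 * φ + 2) * pentagonGauge (b - a : Plane) :=
    fun a b hab => ih (a, b) (lt_of_mul_lt_mul_left hab hc.le)
  by_cases huw : w = u
  · subst huw
    refine ⟨SimpleGraph.Walk.nil, ?_⟩
    rw [walkLength_nil]
    obtain ⟨i, hi⟩ := exists_pentagonGauge_eq (w - w : Plane)
    rw [hi, sub_self]
    simp [pentagonForm]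
  by_cases hle : pentagonGauge (w - u : Plane) ≤ pentagonGauge (u - w : Plane)
  · obtain ⟨v, q, huv, hwq, a, b, ha, hb, da, db, h | h | h⟩ := exists_step huw hle
    · obtain ⟨p, hp⟩ := ih' v w (by linarith)
      refine ⟨p.cons huv, ?_⟩
      rw [walkLength_cons]
      linarith
    · obtain ⟨p, hp⟩ := ih' u q (by linarith)
      refine ⟨(p.reverse.cons hwq).reverse, ?_⟩
      rw [walkLength_reverse, walkLength_cons, walkLength_reverse]
      linarith
    -- After both steps the roles swap: `v - q` is the controlled gauge, so induction gives a walk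
    -- from `q` to `v`, which is then traversed backwards.
    · obtain ⟨p, hp⟩ := ih' q v (by linarith)
      refine ⟨((p.cons hwq).reverse).cons huv, ?_⟩
      rw [walkLength_cons, walkLength_reverse, walkLength_cons]
      linarith
  · have hlt := mul_lt_mul_of_pos_left (not_le.1 hle) hc
    obtain ⟨p, hp⟩ := ih' w u hlt
    exact ⟨p.reverse, by rw [walkLength_reverse]; linarith⟩

end

theorem mainTheorem1 (P : Finset Plane) (hP : InGeneralPosition 5 P) :
    IsGeometricSpanner (thetaGraph 5 P) (Real.sqrt (50 + 22 * Real.sqrt 5)) ∧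
      spanningRatio (thetaGraph 5 P) ≤ ENNReal.ofReal (Real.sqrt (50 + 22 * Real.sqrt 5)) := by
  have spanner : IsGeometricSpanner (thetaGraph 5 P) (Real.sqrt (50 + 22 * Real.sqrt 5)) := by
    intro u w
    have hmin := min_gauge_le (w - u : Plane)
    rw [neg_sub, ← dist_eq_norm, dist_comm] at hmin
    obtain ⟨p, hp⟩ : ∃ p : (thetaGraph 5 P).Walk u w, walkLength p ≤
        (4 * Real.goldenRatio + 2) * min (pentagonGauge (w - u : Plane)) (pentagonGauge (u - w : Plane)) := by
      rcases min_choice (pentagonGauge (w - u : Plane)) (pentagonGauge (u - w : Plane)) with h | h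
      · rw [h]
        exact exists_walk_le_gauge P u w
      · rw [h]
        obtain ⟨p, hp⟩ := exists_walk_le_gauge P w u
        exact ⟨p.reverse, by rwa [walkLength_reverse]⟩
    exact ⟨p.bypass, p.bypass_isPath, (walkLength_bypass_le p).trans (hp.trans hmin)⟩
  refine ⟨spanner, iInf₂_le (Real.toNNReal (Real.sqrt (50 + 22 * Real.sqrt 5))) ?_⟩
  rwa [Real.coe_toNNReal _ (Real.sqrt_nonneg _)]
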